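/- Let $d \ge 0$ and let $G$ be $U(d)$ or $SU(d)$, with Lie algebra $\mathfrak g = \mathfrak u(d)$ (skew-Hermitian $d\times d$ matrices) or $\mathfrak g=\mathfrak{su}(d)$ (traceless skew-Hermitian $d\times d$ matrices), respectively. A maximal torus of $G$ is a closed, connected, abelian subgroup of $G$ that is maximal under inclusion among such subgroups, and a subgroup of $G$ has maximal rank if it contains a maximal torus of $G$. An element $g\in G$ is called general if the closure of $\{g^k : k\in\mathbb N\}$ is a maximal torus of $G$. For a subgroup $H$ let $H^0$ be its identity component, and let $\|\cdot\|$ be the operator norm with respect to the Euclidean norm on $\mathbb C^d$. (1) Let $H\subseteq G$ be a closed subgroup of maximal rank with $H\neq H^0$. Then every $g\in H\setminus H^0$ satisfies $\|g-I\|\ge\sqrt2$. (2) Let $X_1,\dots,X_m\in\mathfrak g$ and, for $\varepsilon>0$, let $H_\varepsilon=\overline{\langle \exp(\varepsilon X_1),\dots,\exp(\varepsilon X_m)\rangle}$ be the closure of the subgroup generated by the gates $\exp(\varepsilon X_i)$. If $\varepsilon>0$ is such that $\|\exp(\varepsilon X_i)-I\|<\sqrt2$ for all $i$ and $H_\varepsilon$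 has maximal rank in $G$, then $H_\varepsilon$ is connected, that is, $H_\varepsilon=H_\varepsilon^0$. (3) In the situation of (2), there is $\varepsilon_0>0$ (depending on $X_1,\dots,X_m$) such that every $\varepsilon\in(0,\varepsilon_0)$ satisfies $\|\exp(\varepsilon X_i)-I\|<\sqrt2$ for all $i$; consequently $H_\varepsilon$ is connected, $H_\varepsilon=H_\varepsilon^0$, for every $\varepsilon\in(0,\varepsilon_0)$ for which $H_\varepsilon$ has maximal rank in $G$, in particular for every such $\varepsilon$ for which one of the gates $\exp(\varepsilon X_i)$ is a general element of $G$. -/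

import Mathlib

namespace SmallStep

section General

variable {Γ : Type*} [Group Γ] [TopologicalSpace Γ]

/-- `T` is a closed, connected, abelian subgroup of the subgroup `G` of `Γ`. (The groups `G`
considered below are closed in `Γ`, so that being closed in `G` and in `Γ` is the same.) -/
def IsTorusIn (G T : Subgroup Γ) : Prop :=
  T ≤ G ∧ IsClosed (T : Set Γ) ∧ IsConnected (T : Set Γ) ∧ ∀ a ∈ T, ∀ b ∈ T, a * b = b * a

/-- `T` is a maximal torus of `G`: a closed, connected, abelian subgroup of `G` that is maximal
under inclusion among these. -/
def IsMaximalTorus (G T : Subgroup Γ) : Prop :=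
  Maximal (IsTorusIn G) T

/-- `H` has maximal rank in `G`: it is a subgroup of `G` and contains a maximal torus of `G`. -/
def HasMaximalRank (G H : Subgroup Γ) : Prop :=
  H ≤ G ∧ ∃ T : Subgroup Γ, IsMaximalTorus G T ∧ T ≤ H

/-- `g` is a general element of `G`: the closure of the set of its powers is a maximal torus
of `G`. -/
def IsGeneralElement (G : Subgroup Γ) (g : Γ) : Prop :=
  ∃ T : Subgroup Γ, IsMaximalTorus G T ∧ closure (Set.range fun k : ℕ => g ^ k) = (T : Set Γ)

/-- The identity component `H⁰` of the topological group `H`, seen as a subgroup of `Γ`. -/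
def identityComponent [IsTopologicalGroup Γ] (H : Subgroup Γ) : Subgroup Γ :=
  (Subgroup.connectedComponentOfOne H).map H.subtype

end General

/-- The unitary group `U(d)`, as a type. -/
abbrev U (d : ℕ) : Type := Matrix.unitaryGroup (Fin d) ℂ

/-- The special unitary group `SU(d)`, as a subgroup of `U(d)`. -/
def SU (d : ℕ) : Subgroup (U d) where
  carrier := {g | (g : Matrix (Fin d) (Fin d) ℂ) ∈ Matrix.specialUnitaryGroup (Fin d) ℂ}
  mul_mem' {a b} ha hb := (Matrix.specialUnitaryGroup (Fin d) ℂ).mul_mem ha hb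
  one_mem' := (Matrix.specialUnitaryGroup (Fin d) ℂ).one_mem
  inv_mem' {a} ha := (star (⟨a, ha⟩ : Matrix.specialUnitaryGroup (Fin d) ℂ)).2

/-- The Lie algebra `𝔲(d)` of skew-Hermitian matrices, as a type. -/
abbrev LieU (d : ℕ) : Type := skewAdjoint (Matrix (Fin d) (Fin d) ℂ)

/-- The Lie algebra `𝔰𝔲(d)` of traceless skew-Hermitian matrices, as a subset of `𝔲(d)`. -/
def LieSU (d : ℕ) : Set (LieU d) :=
  {X | (X : Matrix (Fin d) (Fin d) ℂ).trace = 0}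

/-- The operator norm distance `‖g - I‖` with respect to the Euclidean norm of `ℂᵈ`. -/
noncomputable def distOne {d : ℕ} (g : U d) : ℝ :=
  ‖Matrix.toEuclideanCLM (n := Fin d) (𝕜 := ℂ) ((g : Matrix (Fin d) (Fin d) ℂ) - 1)‖

theorem exp_mem {d : ℕ} (ε : ℝ) (X : LieU d) :
    NormedSpace.exp (ε • (X : Matrix (Fin d) (Fin d) ℂ)) ∈ Matrix.unitaryGroup (Fin d) ℂ := by
  have hX : star (X : Matrix (Fin d) (Fin d) ℂ) = -(X : Matrix (Fin d) (Fin d) ℂ) :=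
    skewAdjoint.mem_iff.mp X.2
  rw [Matrix.mem_unitaryGroup_iff, Matrix.star_eq_conjTranspose, ← Matrix.exp_conjTranspose,
    ← Matrix.star_eq_conjTranspose, star_smul, hX, star_trivial, smul_neg,
    ← Matrix.exp_add_of_commute _ _
      (Commute.refl (ε • (X : Matrix (Fin d) (Fin d) ℂ))).neg_right, add_neg_cancel,
    NormedSpace.exp_zero]

/-- The gate `exp(εX)`. -/
noncomputable def gate {d : ℕ} (ε : ℝ) (X : LieU d) : U d :=
  ⟨NormedSpace.exp (ε • (X : Matrix (Fin d) (Fin d) ℂ)), exp_mem ε X⟩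

/-- `H_ε`, the closure of the subgroup generated by the gates `exp(εX₁), …, exp(εXₘ)`. -/
noncomputable def gateGroup {d m : ℕ} (ε : ℝ) (X : Fin m → LieU d) : Subgroup (U d) :=
  (Subgroup.closure (Set.range fun i => gate ε (X i))).topologicalClosure

end SmallStep

/-! Everything reduces to one claim: an element `g` of a closed subgroup `H` of maximal rank with
`‖g - I‖ < √2` lies in `H⁰`. Commuting unitaries are simultaneously diagonalizable, so after
conjugation `H` becomes a group `K` containing all diagonal matrices of `G`
(`IsMaximalTorus.exists_conj_mem`).

The Lie algebra of `K` then contains the traceless diagonal matrices, so it splits into root spaces.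
The roots that occur define an equivalence relation on the coordinates, `Linked`. Modulo scalars,
the Lie algebra consists of all skew-Hermitian matrices that preserve the resulting blocks
(`linkedProjection_commute`, `exists_add_scalar_of_commute`).

An element of `K` normalizes this Lie algebra, hence permutes the blocks. A vanishing diagonal entry
would force distance at least `√2` from `I` (`apply_self_ne_zero`), so a closer `g` fixes every
block. Its principal logarithm does too, and therefore lies in the Lie algebra up to a scalar
(`exists_eq_exp_mul_scalar`). Thus `g` is a point of a one-parameter group in `K` times an element
of the connected diagonal group of `G`, and it is joined to `1` inside `K`.

For the gates: `H_ε⁰` is a closed subgroup containing all generators, so it is `H_ε`. -/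

namespace SmallStep

open Filter Topology
open scoped Matrix.Norms.L2Operator ComplexConjugate

/-! ### The Lie product formula. -/

section Trotter

variable {A : Type*} [NormedRing A]

theorem norm_pow_sub_pow_le_mul {a b : A} (ha : ‖a‖ ≤ 1) (hb : ‖b‖ ≤ 1) (n : ℕ) :
    ‖a ^ n - b ^ n‖ ≤ n * ‖a - b‖ := by
  induction n with
  | zero => simp
  | succ n ih =>
    -- The exponent 1 is separate because `‖a ^ 0‖ = ‖1‖` is not assumed to be at most 1.
    rcases n with _ | n
    · simp
    have h : a ^ (n + 1 + 1) - b ^ (n + 1 + 1) =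
        a ^ (n + 1) * (a - b) + (a ^ (n + 1) - b ^ (n + 1)) * b := by
      rw [pow_succ a (n + 1), pow_succ b (n + 1)]; noncomm_ring
    have h1 : ‖a ^ (n + 1)‖ ≤ 1 :=
      (norm_pow_le' a n.succ_pos).trans (pow_le_one₀ (norm_nonneg _) ha)
    calc ‖a ^ (n + 1 + 1) - b ^ (n + 1 + 1)‖
        ≤ ‖a ^ (n + 1)‖ * ‖a - b‖ + ‖a ^ (n + 1) - b ^ (n + 1)‖ * ‖b‖ := by
          rw [h]; exact (norm_add_le _ _).trans (add_le_add (norm_mul_le _ _) (norm_mul_le _ _))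
      _ ≤ 1 * ‖a - b‖ + (((n + 1 : ℕ) : ℝ) * ‖a - b‖) * 1 := by gcongr
      _ = ((n + 1 + 1 : ℕ) : ℝ) * ‖a - b‖ := by push_cast; ring

variable [NormedAlgebra ℝ A] [CompleteSpace A]

/-- The Lie product formula for two one-parameter groups of contractions. -/
theorem tendsto_exp_mul_exp_pow {X Y : A} (hX : ∀ t : ℝ, ‖NormedSpace.exp (t • X)‖ ≤ 1)
    (hY : ∀ t : ℝ, ‖NormedSpace.exp (t • Y)‖ ≤ 1)
    (hXY : ∀ t : ℝ, ‖NormedSpace.exp (t • (X + Y))‖ ≤ 1) :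
    Tendsto (fun n : ℕ => (NormedSpace.exp ((n : ℝ)⁻¹ • X) * NormedSpace.exp ((n : ℝ)⁻¹ • Y)) ^ n)
      atTop (𝓝 (NormedSpace.exp (X + Y))) := by
  let _ : NormedAlgebra ℚ A := .restrictScalars ℚ ℝ A
  -- The two curves agree to first order at 0, so their difference at `1/n` is `o(1/n)`; taking
  -- `n`-th powers of contractions costs only a factor `n`.
  have hd : HasDerivAt (fun t : ℝ => NormedSpace.exp (t • X) * NormedSpace.exp (t • Y) -
      NormedSpace.exp (t • (X + Y))) 0 0 := by
    have := ((hasDerivAt_exp_smul_const X (0 : ℝ)).mul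
      (hasDerivAt_exp_smul_const Y (0 : ℝ))).sub (hasDerivAt_exp_smul_const (X + Y) (0 : ℝ))
    simpa using! this
  have ht : Tendsto (fun n : ℕ => (n : ℝ)⁻¹) atTop (𝓝[≠] 0) := by
    refine tendsto_nhdsWithin_iff.2 ⟨tendsto_inv_atTop_nhds_zero_nat, ?_⟩
    filter_upwards [eventually_gt_atTop 0] with n hn
    simpa using hn.ne'
  have h0 := (hd.tendsto_slope_zero.comp ht).norm
  rw [norm_zero] at h0
  rw [tendsto_iff_norm_sub_tendsto_zero]
  refine squeeze_zero' (Eventually.of_forall fun _ => norm_nonneg _) ?_ h0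
  filter_upwards [eventually_gt_atTop 0] with n hn
  have hn' : (n : ℝ) ≠ 0 := by positivity
  have h1 : NormedSpace.exp (X + Y) = NormedSpace.exp ((n : ℝ)⁻¹ • (X + Y)) ^ n := by
    rw [← NormedSpace.exp_nsmul, ← Nat.cast_smul_eq_nsmul ℝ, smul_smul, mul_inv_cancel₀ hn',
      one_smul]
  rw [h1]
  refine (norm_pow_sub_pow_le_mul ?_ (hXY _) n).trans_eq ?_
  · exact (norm_mul_le _ _).trans (mul_le_one₀ (hX _) (norm_nonneg _) (hY _))
  · simp [norm_smul]

end Trotter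

/-! ### The Lie algebra of a closed subgroup of `U(d)`. -/

variable {d : ℕ}

theorem isClosed_coe_image {K : Subgroup (U d)} (hK : IsClosed (K : Set (U d))) :
    IsClosed ((fun g : U d => (g : Matrix (Fin d) (Fin d) ℂ)) '' (K : Set (U d))) :=
  (isClosed_unitary (R := Matrix (Fin d) (Fin d) ℂ)).isClosedEmbedding_subtypeVal.isClosedMap _ hK

/-- The set of `X` such that the one-parameter group of `X` lies in `K`. -/
def lieSet (K : Subgroup (U d)) : Set (Matrix (Fin d) (Fin d) ℂ) :=
  {X | star X = -X ∧ ∀ t : ℝ, ∃ k ∈ K, (k : Matrix (Fin d) (Fin d) ℂ) = NormedSpace.exp (t • X)}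

theorem norm_coe_le_one (g : U d) : ‖(g : Matrix (Fin d) (Fin d) ℂ)‖ ≤ 1 := by
  nontriviality Matrix (Fin d) (Fin d) ℂ
  exact (CStarRing.norm_of_mem_unitary g.2).le

theorem norm_exp_smul_le {X : Matrix (Fin d) (Fin d) ℂ} (hX : star X = -X) (t : ℝ) :
    ‖NormedSpace.exp (t • X)‖ ≤ 1 :=
  norm_coe_le_one (gate t ⟨X, skewAdjoint.mem_iff.2 hX⟩)

theorem smul_mem_lieSet {K : Subgroup (U d)} {X : Matrix (Fin d) (Fin d) ℂ} (hX : X ∈ lieSet K)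
    (c : ℝ) : c • X ∈ lieSet K :=
  ⟨by rw [star_smul, hX.1, star_trivial, smul_neg], fun t => by
    simpa only [smul_smul] using hX.2 (t * c)⟩

theorem add_mem_lieSet {K : Subgroup (U d)} (hK : IsClosed (K : Set (U d)))
    {X Y : Matrix (Fin d) (Fin d) ℂ} (hX : X ∈ lieSet K) (hY : Y ∈ lieSet K) :
    X + Y ∈ lieSet K := by
  have key : ∀ {X Y : Matrix (Fin d) (Fin d) ℂ}, X ∈ lieSet K → Y ∈ lieSet K →
      ∃ k ∈ K, (k : Matrix (Fin d) (Fin d) ℂ) = NormedSpace.exp (X + Y) := by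
    intro X Y hX hY
    have hXY : star (X + Y) = -(X + Y) := by rw [star_add, hX.1, hY.1, neg_add]
    refine (isClosed_coe_image hK).mem_of_tendsto (tendsto_exp_mul_exp_pow
      (norm_exp_smul_le hX.1) (norm_exp_smul_le hY.1) (norm_exp_smul_le hXY))
      (Eventually.of_forall fun n => ?_)
    obtain ⟨a, ha, ha'⟩ := hX.2 (n : ℝ)⁻¹
    obtain ⟨b, hb, hb'⟩ := hY.2 (n : ℝ)⁻¹
    exact ⟨(a * b) ^ n, K.pow_mem (K.mul_mem ha hb) n, by simp [ha', hb']⟩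
  refine ⟨by rw [star_add, hX.1, hY.1, neg_add], fun t => ?_⟩
  rw [smul_add]
  exact key (smul_mem_lieSet hX t) (smul_mem_lieSet hY t)

/-- The Lie algebra of a closed subgroup of `U(d)`, as a real space of matrices. -/
def lieSubmodule (K : Subgroup (U d)) (hK : IsClosed (K : Set (U d))) :
    Submodule ℝ (Matrix (Fin d) (Fin d) ℂ) where
  carrier := lieSet K
  add_mem' := add_mem_lieSet hK
  zero_mem' := ⟨by simp, fun t => ⟨1, K.one_mem, by simp⟩⟩
  smul_mem' c _ hX := smul_mem_lieSet hX c

section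

variable {K : Subgroup (U d)} {hK : IsClosed (K : Set (U d))}

theorem conj_mem_lieSubmodule {X : Matrix (Fin d) (Fin d) ℂ} (hX : X ∈ lieSubmodule K hK)
    {g : U d} (hg : g ∈ K) :
    (g : Matrix (Fin d) (Fin d) ℂ) * X * star (g : Matrix (Fin d) (Fin d) ℂ) ∈
      lieSubmodule K hK := by
  refine ⟨by simp [hX.1, mul_assoc], fun t => ?_⟩
  obtain ⟨k, hk, hk'⟩ := hX.2 t
  refine ⟨g * k * g⁻¹, K.mul_mem (K.mul_mem hg hk) (K.inv_mem hg), ?_⟩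
  have h := Matrix.exp_units_conj (𝔸 := ℂ) (Unitary.toUnits g) (t • X)
  have h1 : ((Unitary.toUnits g : (Matrix (Fin d) (Fin d) ℂ)ˣ) : Matrix (Fin d) (Fin d) ℂ) = g :=
    rfl
  have h2 : (((Unitary.toUnits g)⁻¹ : (Matrix (Fin d) (Fin d) ℂ)ˣ) : Matrix (Fin d) (Fin d) ℂ) =
    star (g : Matrix (Fin d) (Fin d) ℂ) := rfl
  rw [h1, h2, ← hk', mul_smul_comm, smul_mul_assoc] at h
  exact h.symm

/-- The bracket is the derivative at 0 of `exp(tX) Y exp(-tX)`, a curve in a finite-dimensional,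
hence closed, subspace. -/
theorem lie_mem_lieSubmodule {X Y : Matrix (Fin d) (Fin d) ℂ} (hX : X ∈ lieSubmodule K hK)
    (hY : Y ∈ lieSubmodule K hK) : X * Y - Y * X ∈ lieSubmodule K hK := by
  let _ : NormedAlgebra ℝ (Matrix (Fin d) (Fin d) ℂ) := .restrictScalars ℝ ℂ _
  let _ : NormedAlgebra ℚ (Matrix (Fin d) (Fin d) ℂ) := .restrictScalars ℚ ℝ _
  have hd : HasDerivAt (fun t : ℝ => NormedSpace.exp (t • X) * Y * NormedSpace.exp (t • -X))
      (X * Y - Y * X) 0 := by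
    have := ((hasDerivAt_exp_smul_const X (0 : ℝ)).mul_const Y).mul
      (hasDerivAt_exp_smul_const (-X) (0 : ℝ))
    simpa [sub_eq_add_neg] using! this
  have hc : IsClosed (lieSubmodule K hK : Set (Matrix (Fin d) (Fin d) ℂ)) :=
    Submodule.closed_of_finiteDimensional _
  refine hc.mem_of_tendsto hd.tendsto_slope_zero (Eventually.of_forall fun t => ?_)
  refine Submodule.smul_mem _ _ (Submodule.sub_mem _ ?_ (by simpa using hY))
  obtain ⟨k, hk, hk'⟩ := hX.2 t
  have hs : star (NormedSpace.exp (t • X)) = NormedSpace.exp (t • -X) := by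
    rw [NormedSpace.star_exp, star_smul, hX.1, star_trivial]
  have := conj_mem_lieSubmodule hY hk
  rw [hk', hs] at this
  simpa using this

end

/-! ### Root spaces and linked coordinates. -/

section

variable {d : ℕ} {K : Subgroup (U d)} {hK : IsClosed (K : Set (U d))}

theorem commutator_diagonal_apply (v : Fin d → ℂ) (X : Matrix (Fin d) (Fin d) ℂ) (a b : Fin d) :
    (Matrix.diagonal v * X - X * Matrix.diagonal v) a b = (v a - v b) * X a b := by
  rw [Matrix.sub_apply, Matrix.diagonal_mul, Matrix.mul_diagonal]; ring

theorem apply_eq_neg_conj {X : Matrix (Fin d) (Fin d) ℂ} (hX : star X = -X) (a b : Fin d) :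
    X a b = -conj (X b a) := by
  have := congrFun (congrFun hX a) b
  rw [Matrix.star_apply, Matrix.neg_apply] at this
  rw [← Complex.star_def, this, neg_neg]

/-- The skew-Hermitian matrix with entry `z` at `(i, j)` and zeros outside `(i, j)`, `(j, i)`. -/
noncomputable def rootMatrix (i j : Fin d) (z : ℂ) : Matrix (Fin d) (Fin d) ℂ :=
  Matrix.single i j z - Matrix.single j i (conj z)

theorem rootMatrix_add (i j : Fin d) (z w : ℂ) :
    rootMatrix i j (z + w) = rootMatrix i j z + rootMatrix i j w := by
  simp only [rootMatrix, map_add, Matrix.single_add]; abel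

theorem rootMatrix_smul (i j : Fin d) (r : ℝ) (z : ℂ) :
    rootMatrix i j (r * z) = r • rootMatrix i j z := by
  simp [rootMatrix, smul_sub, Matrix.smul_single]

/-- The diagonal skew-Hermitian matrix `i (E_ii - E_jj)`. -/
noncomputable def corootMatrix (i j : Fin d) : Matrix (Fin d) (Fin d) ℂ :=
  Matrix.diagonal fun k => Complex.I * ((Pi.single i 1 - Pi.single j 1 : Fin d → ℝ) k : ℂ)

/-- `K` contains all one-parameter groups of traceless diagonal matrices. -/
def ContainsCartan (K : Subgroup (U d)) : Prop :=
  ∀ θ : Fin d → ℝ, ∑ k, θ k = 0 → Matrix.diagonal (fun k => Complex.I * (θ k : ℂ)) ∈ lieSet K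

theorem corootMatrix_mem (hD : ContainsCartan K) (i j : Fin d) :
    corootMatrix i j ∈ lieSubmodule K hK :=
  hD _ (by simp [Finset.sum_sub_distrib])

theorem commutator_corootMatrix_apply (i j : Fin d) (X : Matrix (Fin d) (Fin d) ℂ) (a b : Fin d) :
    (corootMatrix i j * X - X * corootMatrix i j) a b =
      Complex.I * ((if a = i then 1 else 0) - (if a = j then 1 else 0) -
        ((if b = i then 1 else 0) - (if b = j then 1 else 0))) * X a b := by
  rw [corootMatrix, commutator_diagonal_apply]
  simp only [Pi.sub_apply, Pi.single_apply, Complex.ofReal_sub, apply_ite Complex.ofReal,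
    Complex.ofReal_one, Complex.ofReal_zero]
  ring

/-- The operator `ad` of `corootMatrix i j` multiplies each entry by `I * c` with `c ∈ {0, ±1, ±2}`,
and `c = ±2` occurs only at `(i, j)` and `(j, i)`. Hence `(ad⁴ + ad²) / 12`, which multiplies by
`(c⁴ - c²) / 12`, is the projection onto these two entries. -/
theorem rootMatrix_apply_mem (hD : ContainsCartan K) {X : Matrix (Fin d) (Fin d) ℂ}
    (hX : X ∈ lieSubmodule K hK) {i j : Fin d} (hij : i ≠ j) :
    rootMatrix i j (X i j) ∈ lieSubmodule K hK := by
  have hDm : corootMatrix i j ∈ lieSubmodule K hK := corootMatrix_mem hD i j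
  have h2 := lie_mem_lieSubmodule hDm (lie_mem_lieSubmodule hDm hX)
  have h4 := lie_mem_lieSubmodule hDm (lie_mem_lieSubmodule hDm h2)
  have h5 := Submodule.smul_mem _ (12⁻¹ : ℝ) (Submodule.add_mem _ h4 h2)
  convert h5 using 1
  clear h5 h4 h2 hDm
  ext a b
  have hji : X j i = -conj (X i j) := apply_eq_neg_conj hX.1 j i
  rw [Matrix.smul_apply, Matrix.add_apply]
  simp only [commutator_corootMatrix_apply]
  have h : ∀ c x : ℂ, (12⁻¹ : ℝ) • (Complex.I * c * (Complex.I * c * (Complex.I * c *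
      (Complex.I * c * x))) + Complex.I * c * (Complex.I * c * x)) =
      12⁻¹ * (c ^ 4 - c ^ 2) * x := by
    intro c x
    rw [Complex.real_smul]
    push_cast
    linear_combination (12⁻¹ * c ^ 4 * x) * Complex.I_pow_four + (12⁻¹ * c ^ 2 * x) * Complex.I_sq
  rw [h]
  simp only [rootMatrix, Matrix.sub_apply, Matrix.single_apply]
  by_cases hai : a = i <;> by_cases haj : a = j <;> by_cases hbi : b = i <;> by_cases hbj : b = j <;>
    first
    | (exfalso; grind)
    | (simp [hai, haj, hbi, hbj, hij, hji, Ne.symm hij, eq_comm (a := i), eq_comm (a := j)]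
       try norm_num)

/-- Bracketing with the coroot multiplies the parameter of a root matrix by `2i`, and `X i j` and
`2i * X i j` span `ℂ` over `ℝ`. -/
theorem rootMatrix_mem (hD : ContainsCartan K) {X : Matrix (Fin d) (Fin d) ℂ}
    (hX : X ∈ lieSubmodule K hK) {i j : Fin d} (hij : i ≠ j) (h0 : X i j ≠ 0) (z : ℂ) :
    rootMatrix i j z ∈ lieSubmodule K hK := by
  have h1 := rootMatrix_apply_mem hD hX hij
  have h2 := lie_mem_lieSubmodule (corootMatrix_mem hD i j) h1
  have h3 : corootMatrix i j * rootMatrix i j (X i j) - rootMatrix i j (X i j) * corootMatrix i j =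
      rootMatrix i j (2 * Complex.I * X i j) := by
    ext a b
    rw [commutator_corootMatrix_apply]
    simp only [rootMatrix, Matrix.sub_apply, Matrix.single_apply, map_mul, Complex.conj_I,
      Complex.conj_ofNat]
    by_cases hai : a = i <;> by_cases haj : a = j <;> by_cases hbi : b = i <;>
      by_cases hbj : b = j <;>
    first
    | (exfalso; grind)
    | (simp [hai, haj, hbi, hbj, hij, Ne.symm hij, eq_comm (a := i), eq_comm (a := j)]
       try first | (left; ring) | ring)
  rw [h3] at h2
  have h4 : z = ((z / X i j).re : ℂ) * X i j + ((z / X i j).im / 2 : ℝ) * (2 * Complex.I * X i j) := by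
    have h5 := Complex.re_add_im (z / X i j)
    have h6 : z = z / X i j * X i j := (div_mul_cancel₀ _ h0).symm
    push_cast
    linear_combination h6 - X i j * h5
  rw [h4, rootMatrix_add, rootMatrix_smul, rootMatrix_smul]
  exact Submodule.add_mem _ (Submodule.smul_mem _ _ h1) (Submodule.smul_mem _ _ h2)

theorem mem_of_forall_rootMatrix_mem {B : Matrix (Fin d) (Fin d) ℂ} (hB : star B = -B)
    (h : ∀ i j, rootMatrix i j (B i j) ∈ lieSubmodule K hK) : B ∈ lieSubmodule K hK := by
  -- Each off-diagonal pair is met in both orders, and `rootMatrix i i` doubles an imaginary entry,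
  -- hence the factor 2.
  have h1 : (2 : ℝ) • B = ∑ i, ∑ j, rootMatrix i j (B i j) := by
    have e1 := Matrix.matrix_eq_sum_single B
    have e2 : -B = ∑ i, ∑ j, Matrix.single j i (conj (B i j)) := by
      rw [← hB, Finset.sum_comm]
      exact Matrix.matrix_eq_sum_single (star B)
    simp only [rootMatrix, Finset.sum_sub_distrib]
    rw [← e1, ← e2, two_smul, sub_neg_eq_add]
  have h2 : B = (2⁻¹ : ℝ) • ∑ i, ∑ j, rootMatrix i j (B i j) := by
    rw [← h1, smul_smul]; norm_num
  rw [h2]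
  exact Submodule.smul_mem _ _ (Submodule.sum_mem _ fun i _ => Submodule.sum_mem _ fun j _ => h i j)

/-- Two coordinates are linked if they are equal or the Lie algebra of `K` mixes them. -/
def Linked (K : Subgroup (U d)) (i j : Fin d) : Prop :=
  i = j ∨ ∃ X ∈ lieSet K, X i j ≠ 0

theorem Linked.symm {i j : Fin d} (h : Linked K i j) : Linked K j i := by
  rcases h with rfl | ⟨X, hX, h0⟩
  · exact .inl rfl
  · exact .inr ⟨X, hX, by rw [apply_eq_neg_conj hX.1 j i]; simpa using h0⟩

include hK in
theorem Linked.trans (hD : ContainsCartan K) {i j k : Fin d} (h : Linked K i j)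
    (h' : Linked K j k) : Linked K i k := by
  by_cases hik : i = k
  · exact .inl hik
  by_cases hij : i = j
  · rwa [hij]
  by_cases hjk : j = k
  · rwa [← hjk]
  obtain ⟨X, hX, h0⟩ := h.resolve_left hij
  obtain ⟨Y, hY, h0'⟩ := h'.resolve_left hjk
  -- The bracket of root matrices for `(i, j)` and `(j, k)` has a nonzero entry at `(i, k)`.
  refine .inr ⟨_, lie_mem_lieSubmodule (rootMatrix_mem (hK := hK) hD hX hij h0 1)
    (rootMatrix_mem (hK := hK) hD hY hjk h0' 1), ?_⟩
  simp [rootMatrix, Matrix.mul_sub, Matrix.sub_mul, Matrix.single_mul_single_same,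
    Matrix.single_mul_single_of_ne, hij, hjk, hik, Ne.symm hij, Ne.symm hjk,
    Ne.symm hik]

end

/-! ### Elements close to the identity preserve the blocks and have a logarithm in the Lie algebra
up to scalars. -/

section

variable {d : ℕ} {K : Subgroup (U d)} {hK : IsClosed (K : Set (U d))}

theorem distOne_eq_norm (g : U d) : distOne g = ‖(g : Matrix (Fin d) (Fin d) ℂ) - 1‖ := rfl

/-- For unitary `M` the `(a, a)` entry of `(M - 1)⋆(M - 1)` is `2 - 2 Re M_aa`. If `M_aa = 0`, this
gives `‖M - 1‖² ≥ 2`. -/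
theorem apply_self_ne_zero {g : U d} (hg : distOne g < √2) (a : Fin d) :
    (g : Matrix (Fin d) (Fin d) ℂ) a a ≠ 0 := by
  intro h0
  set M : Matrix (Fin d) (Fin d) ℂ := (g : Matrix (Fin d) (Fin d) ℂ) with hM
  have hN : star (M - 1) * (M - 1) = 1 + 1 - M - star M := by
    have : star M * M = 1 := Unitary.star_mul_self_of_mem g.2
    rw [star_sub, star_one, sub_mul, mul_sub, this]; noncomm_ring
  have h1 : Matrix.toEuclideanCLM (n := Fin d) (𝕜 := ℂ) (star (M - 1) * (M - 1))
      (EuclideanSpace.single a 1) a = 2 := by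
    rw [hN, Matrix.ofLp_toEuclideanCLM]
    simp [Matrix.mulVec_single, Matrix.sub_apply, Matrix.add_apply, h0]
    norm_num
  have h2 := (PiLp.norm_apply_le (Matrix.toEuclideanCLM (n := Fin d) (𝕜 := ℂ)
      (star (M - 1) * (M - 1)) (EuclideanSpace.single a 1)) a).trans
    (ContinuousLinearMap.le_opNorm _ _)
  rw [h1, ← Matrix.cstar_norm_def, CStarRing.norm_star_mul_self, PiLp.norm_single] at h2
  rw [distOne_eq_norm, ← hM] at hg
  have h3 := Real.mul_self_sqrt (show (0 : ℝ) ≤ 2 by norm_num)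
  have h4 := norm_nonneg (M - 1)
  norm_num at h2
  nlinarith

open Classical in
/-- The projection onto the coordinates linked to `i`. -/
noncomputable def linkedProjection (K : Subgroup (U d)) (i : Fin d) :
    Matrix (Fin d) (Fin d) ℂ :=
  Matrix.diagonal fun j => if Linked K i j then 1 else 0

theorem star_linkedProjection (i : Fin d) :
    star (linkedProjection K i) = linkedProjection K i := by
  rw [linkedProjection, Matrix.star_eq_conjTranspose, Matrix.diagonal_conjTranspose]
  congr 1
  ext j
  simp only [Pi.star_apply]
  split_ifs <;> simp

theorem linkedProjection_commute (hD : ContainsCartan K) (i : Fin d)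
    {X : Matrix (Fin d) (Fin d) ℂ} (hX : X ∈ lieSubmodule K hK) :
    linkedProjection K i * X = X * linkedProjection K i := by
  ext a b
  rw [linkedProjection, Matrix.diagonal_mul, Matrix.mul_diagonal]
  by_cases h0 : X a b = 0
  · simp [h0]
  have hab : Linked K a b := .inr ⟨X, hX, h0⟩
  have : Linked K i a ↔ Linked K i b :=
    ⟨fun h => h.trans (hK := hK) hD hab, fun h => h.trans (hK := hK) hD hab.symm⟩
  by_cases h : Linked K i a
  · rw [if_pos h, if_pos (this.1 h), one_mul, mul_one]
  · rw [if_neg h, if_neg (mt this.2 h), zero_mul, mul_zero]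

theorem isDiag_of_commute (hD : ContainsCartan K) {Q : Matrix (Fin d) (Fin d) ℂ}
    (hQ : ∀ X ∈ lieSubmodule K hK, Q * X = X * Q) : Q.IsDiag := by
  intro a b hab
  have h := commutator_corootMatrix_apply a b Q a b
  rw [hQ _ (corootMatrix_mem (hK := hK) hD a b), sub_self, Matrix.zero_apply] at h
  simpa [hab, hab.symm, one_add_one_eq_two] using h.symm

theorem linkedProjection_commute_of_distOne_lt (hK : IsClosed (K : Set (U d)))
    (hD : ContainsCartan K) (i : Fin d) {g : U d}
    (hg : g ∈ K) (hd : distOne g < √2) :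
    linkedProjection K i * (g : Matrix (Fin d) (Fin d) ℂ) = g * linkedProjection K i := by
  set M : Matrix (Fin d) (Fin d) ℂ := (g : Matrix (Fin d) (Fin d) ℂ) with hM
  have hs : star M * M = 1 := Unitary.star_mul_self_of_mem g.2
  have hs' : M * star M = 1 := Unitary.mul_star_self_of_mem g.2
  -- Conjugation by `g` preserves the Lie algebra, so the conjugated projection still commutes with
  -- all of it, in particular with the coroots.
  have hQ : (M * linkedProjection K i * star M).IsDiag := by
    refine isDiag_of_commute (hK := hK) hD fun X hX => ?_
    have h := linkedProjection_commute hD i (conj_mem_lieSubmodule hX (K.inv_mem hg))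
    have h1 : ((g⁻¹ : U d) : Matrix (Fin d) (Fin d) ℂ) = star M := rfl
    rw [h1, star_star] at h
    calc M * linkedProjection K i * star M * X
        = M * (linkedProjection K i * (star M * X * M)) * star M := by
          simp only [mul_assoc, hs', mul_one]
      _ = X * (M * linkedProjection K i * star M) := by
          rw [h]; simp only [← mul_assoc, hs', one_mul]
  have hQM : M * linkedProjection K i * star M * M = M * linkedProjection K i := by
    rw [mul_assoc, hs, mul_one]
  rw [← hQM]
  congr 1
  rw [← hQ.diagonal_diag, linkedProjection]
  congr 1
  ext a
  -- With `Q = M P M⋆` diagonal, the `(a, a)` entry of `Q M = M P` reads `Q_aa M_aa = M_aa P_aa`;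
  -- cancelling `M_aa ≠ 0` yields `Q = P`.
  have h := congrFun (congrFun hQM a) a
  rw [← hQ.diagonal_diag, Matrix.diagonal_mul, linkedProjection, Matrix.mul_diagonal,
    mul_comm] at h
  exact (mul_left_cancel₀ (apply_self_ne_zero hd a) h).symm

theorem exists_add_scalar_of_commute (hD : ContainsCartan K) {A : Matrix (Fin d) (Fin d) ℂ}
    (hA : star A = -A) (hc : ∀ i, linkedProjection K i * A = A * linkedProjection K i) :
    ∃ A₀ ∈ lieSubmodule K hK, ∃ c : ℂ, A = A₀ + Matrix.diagonal fun _ => c := by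
  have hdiag : ∀ a, A a a = Complex.I * ((A a a).im : ℂ) := by
    intro a
    have h := congrArg Complex.re (apply_eq_neg_conj hA a a)
    simp only [Complex.neg_re, Complex.conj_re] at h
    apply Complex.ext <;> simp
    linarith
  set D : Matrix (Fin d) (Fin d) ℂ := Matrix.diagonal fun a => Complex.I * ((A a a).im : ℂ)
    with hDdef
  have hDstar : star D = -D := by
    rw [hDdef, Matrix.star_eq_conjTranspose, Matrix.diagonal_conjTranspose]
    ext a b
    by_cases hab : a = b
    · subst hab; simp
    · simp [hab]
  have hB : A - D ∈ lieSubmodule K hK := by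
    refine mem_of_forall_rootMatrix_mem (by rw [star_sub, hA, hDstar]; abel) fun i j => ?_
    by_cases hij : i = j
    · subst hij
      have h0 : (A - D) i i = 0 := by
        rw [Matrix.sub_apply, hDdef, Matrix.diagonal_apply_eq, ← hdiag, sub_self]
      simp [h0, rootMatrix]
    · have h0 : (A - D) i j = A i j := by
        rw [Matrix.sub_apply, hDdef, Matrix.diagonal_apply_ne _ hij, sub_zero]
      rw [h0]
      by_cases hz : A i j = 0
      · simp [hz, rootMatrix]
      have h := congrFun (congrFun (hc i) i) j
      rw [linkedProjection, Matrix.diagonal_mul, Matrix.mul_diagonal,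
        if_pos (show Linked K i i from .inl rfl), mul_comm] at h
      have h1 := mul_left_cancel₀ hz h
      have hL : Linked K i j := by
        by_contra hn
        rw [if_neg hn] at h1
        exact one_ne_zero h1
      obtain ⟨X, hX, hX0⟩ := hL.resolve_left hij
      exact rootMatrix_mem hD hX hij hX0 _
  -- Subtracting the mean makes the diagonal part traceless, as `ContainsCartan` requires; the mean
  -- becomes the scalar `c`.
  set m : ℝ := (∑ a, (A a a).im) / d with hm
  have hT : Matrix.diagonal (fun a => Complex.I * (((A a a).im - m : ℝ) : ℂ)) ∈
      lieSubmodule K hK := by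
    refine hD _ ?_
    rcases Nat.eq_zero_or_pos d with rfl | h
    · simp
    · rw [Finset.sum_sub_distrib, hm]
      simp only [Finset.sum_const, Finset.card_univ, Fintype.card_fin, nsmul_eq_mul]
      field_simp
      simp
  refine ⟨_, Submodule.add_mem _ hB hT, Complex.I * (m : ℂ), ?_⟩
  rw [add_assoc, Matrix.diagonal_add]
  have : (fun a => Complex.I * (((A a a).im - m : ℝ) : ℂ) + Complex.I * (m : ℂ)) =
      fun a => Complex.I * ((A a a).im : ℂ) := by
    ext a; push_cast; ring
  rw [this, ← hDdef, sub_add_cancel]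

/-- An element of `K` close to the identity is the product of a point on a one-parameter group in
`K` and a scalar matrix in `K`. -/
theorem exists_eq_exp_mul_scalar (hK : IsClosed (K : Set (U d))) (hD : ContainsCartan K)
    {g : U d} (hg : g ∈ K) (hd : distOne g < √2) :
    ∃ X : LieU d, (∀ t : ℝ, gate t X ∈ K) ∧ ∃ s ∈ K,
      (s : Matrix (Fin d) (Fin d) ℂ).IsDiag ∧ g = gate 1 X * s := by
  let _ : NormedAlgebra ℚ (Matrix (Fin d) (Fin d) ℂ) := .restrictScalars ℚ ℂ _
  -- Distance below 2 keeps `-1` out of the spectrum, so the principal logarithm is available.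
  have hd2 : ‖((g : Matrix (Fin d) (Fin d) ℂ) - 1)‖ < 2 := by
    rw [distOne_eq_norm] at hd
    exact hd.trans (by rw [Real.sqrt_lt' (by norm_num)]; norm_num)
  set A : Matrix (Fin d) (Fin d) ℂ := Complex.I • (Unitary.argSelfAdjoint g : Matrix _ _ ℂ) with hA
  have hexp : NormedSpace.exp A = (g : Matrix (Fin d) (Fin d) ℂ) :=
    congrArg Subtype.val (expUnitary_argSelfAdjoint hd2)
  have hAs : star A = -A := by
    rw [hA, star_smul, (Unitary.argSelfAdjoint g).2.star_eq]
    simp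
  -- The logarithm is a continuous function of `g`, so it commutes with whatever commutes with `g`
  -- and `g⋆`.
  have hcomm : ∀ i, linkedProjection K i * A = A * linkedProjection K i := by
    intro i
    have h1 := linkedProjection_commute_of_distOne_lt hK hD i hg hd
    have h2 : Commute (g : Matrix (Fin d) (Fin d) ℂ) (linkedProjection K i) := h1.symm
    have h3 : Commute (star (g : Matrix (Fin d) (Fin d) ℂ)) (linkedProjection K i) := by
      have := congrArg star h1
      rw [star_mul, star_mul, star_linkedProjection] at this
      exact this
    rw [hA, mul_smul_comm, smul_mul_assoc, Unitary.argSelfAdjoint_coe, ((h2.cfc h3 _)).eq]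
  obtain ⟨A₀, hA₀, c, hc⟩ := exists_add_scalar_of_commute (hK := hK) hD hAs hcomm
  have hgate : ∀ t : ℝ, gate t ⟨A₀, skewAdjoint.mem_iff.2 hA₀.1⟩ ∈ K := by
    intro t
    obtain ⟨k, hk, hk'⟩ := hA₀.2 t
    convert hk
    exact Subtype.ext hk'.symm
  refine ⟨⟨A₀, skewAdjoint.mem_iff.2 hA₀.1⟩, hgate, _, K.mul_mem (K.inv_mem (hgate 1)) hg, ?_,
    (mul_inv_cancel_left _ _).symm⟩
  have hcm : Commute A₀ (Matrix.diagonal fun _ => c) := by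
    have := Matrix.scalar_commute c (fun _ => Commute.all _ _) A₀
    exact this.symm
  have h1 : ((gate 1 (⟨A₀, skewAdjoint.mem_iff.2 hA₀.1⟩ : LieU d))⁻¹ * g : U d) =
      NormedSpace.exp (Matrix.diagonal fun _ : Fin d => c) := by
    have h2 : (g : Matrix (Fin d) (Fin d) ℂ) =
        (gate 1 (⟨A₀, skewAdjoint.mem_iff.2 hA₀.1⟩ : LieU d) : Matrix (Fin d) (Fin d) ℂ) *
          NormedSpace.exp (Matrix.diagonal fun _ : Fin d => c) := by
      rw [← hexp, hc, Matrix.exp_add_of_commute _ _ hcm]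
      simp [gate]
    rw [Submonoid.coe_mul, h2, ← mul_assoc]
    have : (((gate 1 (⟨A₀, skewAdjoint.mem_iff.2 hA₀.1⟩ : LieU d))⁻¹ : U d) :
        Matrix (Fin d) (Fin d) ℂ) * (gate 1 (⟨A₀, skewAdjoint.mem_iff.2 hA₀.1⟩ : LieU d)) = 1 := by
      rw [← Submonoid.coe_mul, inv_mul_cancel]; rfl
    rw [this, one_mul]
  rw [h1, Matrix.exp_diagonal]
  exact Matrix.isDiag_diagonal _

end

/-! ### Simultaneous diagonalization, and the determinant of a gate. -/

section

variable {d : ℕ}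

/-- Commuting symmetric operators have a common orthonormal eigenbasis. -/
theorem exists_common_eigenbasis {E : Type*} [NormedAddCommGroup E] [InnerProductSpace ℂ E]
    [FiniteDimensional ℂ E] {n : ℕ} (hn : Module.finrank ℂ E = n) {ι : Type*} (T : ι → E →ₗ[ℂ] E)
    (hT : ∀ i, (T i).IsSymmetric) (hc : Pairwise fun i j => Commute (T i) (T j)) :
    ∃ (b : OrthonormalBasis (Fin n) ℂ E) (χ : ι → Fin n → ℂ), ∀ i j, T i (b j) = χ i j • b j := by
  classical
  let V : (ι → ℂ) → Submodule ℂ E := fun α => ⨅ j, Module.End.eigenspace (T j) (α j)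
  have hI : DirectSum.IsInternal V :=
    LinearMap.IsSymmetric.directSum_isInternal_of_pairwise_commute hT hc
  have hO : OrthogonalFamily ℂ (fun α => V α) fun α => (V α).subtypeₗᵢ :=
    LinearMap.IsSymmetric.orthogonalFamily_iInf_eigenspaces hT
  let b₀ := hI.collectedBasis fun α => (stdOrthonormalBasis ℂ (V α)).toBasis
  have hb₀ : Orthonormal ℂ b₀ := by
    have h := hO.orthonormal_sigma_orthonormal
      (v_family := fun α => stdOrthonormalBasis ℂ (V α))
      (fun α => (stdOrthonormalBasis ℂ (V α)).orthonormal)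
    simpa [b₀] using h
  have : Finite (Σ α, Fin (Module.finrank ℂ (V α))) := Module.Finite.finite_basis b₀
  let _ := Fintype.ofFinite (Σ α, Fin (Module.finrank ℂ (V α)))
  let e := Fintype.equivFinOfCardEq (n := n) (by rw [← Module.finrank_eq_card_basis b₀, hn])
  refine ⟨(b₀.toOrthonormalBasis hb₀).reindex e, fun i j => (e.symm j).1 i, fun i j => ?_⟩
  have h1 : (b₀.toOrthonormalBasis hb₀).reindex e j ∈ V (e.symm j).1 := by
    rw [OrthonormalBasis.reindex_apply, Module.Basis.coe_toOrthonormalBasis]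
    exact hI.collectedBasis_mem _ _
  exact Module.End.mem_eigenspace_iff.1 ((Submodule.mem_iInf _).1 h1 i)

/-- Commuting Hermitian matrices are simultaneously diagonalized by a unitary matrix. -/
theorem exists_unitary_conj_eq_diagonal {ι : Type*} (A : ι → Matrix (Fin d) (Fin d) ℂ)
    (hA : ∀ i, star (A i) = A i) (hc : ∀ i j, Commute (A i) (A j)) :
    ∃ v : U d, ∀ i, ∃ χ : Fin d → ℂ, A i =
      (v : Matrix (Fin d) (Fin d) ℂ) * Matrix.diagonal χ * star (v : Matrix (Fin d) (Fin d) ℂ) := by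
  classical
  let T : ι → EuclideanSpace ℂ (Fin d) →ₗ[ℂ] EuclideanSpace ℂ (Fin d) := fun i =>
    (Matrix.toEuclideanCLM (n := Fin d) (𝕜 := ℂ) (A i)).toLinearMap
  have hT : ∀ i, (T i).IsSymmetric := fun i => by
    rw [← ContinuousLinearMap.isSelfAdjoint_iff_isSymmetric]
    exact (IsSelfAdjoint.map (show IsSelfAdjoint (A i) from hA i) Matrix.toEuclideanCLM)
  have hTc : Pairwise fun i j => Commute (T i) (T j) := fun i j _ => by
    have := (hc i j).map (Matrix.toEuclideanCLM (n := Fin d) (𝕜 := ℂ))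
    exact congrArg ContinuousLinearMap.toLinearMap this.eq
  obtain ⟨b, χ, hb⟩ := exists_common_eigenbasis (n := d) finrank_euclideanSpace_fin T hT hTc
  let v : Matrix (Fin d) (Fin d) ℂ := Matrix.of fun a j => b j a
  have hv : star v * v = 1 := by
    ext i j
    have := orthonormal_iff_ite.1 b.orthonormal i j
    rw [PiLp.inner_apply] at this
    rw [Matrix.mul_apply, Matrix.one_apply, ← this]
    refine Finset.sum_congr rfl fun a _ => ?_
    simp [v, mul_comm]
  have hvm : v ∈ Matrix.unitaryGroup (Fin d) ℂ := Matrix.mem_unitaryGroup_iff'.2 hv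
  refine ⟨⟨v, hvm⟩, fun i => ⟨χ i, ?_⟩⟩
  have h : A i * v = v * Matrix.diagonal (χ i) := by
    ext a j
    have h1 := congrArg (fun x : EuclideanSpace ℂ (Fin d) => x a) (hb i j)
    simp only [T, ContinuousLinearMap.coe_coe, PiLp.smul_apply, smul_eq_mul] at h1
    rw [Matrix.ofLp_toEuclideanCLM] at h1
    rw [Matrix.mul_diagonal, mul_comm]
    exact h1
  rw [← h, mul_assoc]
  have : v * star v = 1 := Matrix.mem_unitaryGroup_iff.1 hvm
  change A i = A i * (v * star v)
  rw [this, mul_one]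

theorem coe_inv_mul_mul (v g : U d) : ((v⁻¹ * g * v : U d) : Matrix (Fin d) (Fin d) ℂ) =
    star (v : Matrix (Fin d) (Fin d) ℂ) * g * v := rfl

/-- A commutative subgroup of `U(d)` is conjugate to a group of diagonal matrices. -/
theorem exists_conj_isDiag {T : Subgroup (U d)} (hT : ∀ a ∈ T, ∀ b ∈ T, a * b = b * a) :
    ∃ v : U d, ∀ g ∈ T, ((v⁻¹ * g * v : U d) : Matrix (Fin d) (Fin d) ℂ).IsDiag := by
  -- Up to real factors these are the Hermitian real and imaginary parts of the elements of `T`.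
  -- They commute because `g⋆ = g⁻¹` also lies in `T`.
  let A : T × Bool → Matrix (Fin d) (Fin d) ℂ := fun p =>
    if p.2 then ((p.1 : U d) : Matrix _ _ ℂ) + star ((p.1 : U d) : Matrix _ _ ℂ)
    else Complex.I • (((p.1 : U d) : Matrix _ _ ℂ) - star ((p.1 : U d) : Matrix _ _ ℂ))
  have hcc : ∀ a b : U d, a ∈ T → b ∈ T →
      Commute (a : Matrix (Fin d) (Fin d) ℂ) (b : Matrix (Fin d) (Fin d) ℂ) :=
    fun a b ha hb => congrArg Subtype.val (hT a ha b hb)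
  obtain ⟨v, hv⟩ := exists_unitary_conj_eq_diagonal A
    (by
      rintro ⟨g, _ | _⟩
      · simp [A, smul_sub, neg_add_eq_sub]
      · simp [A, add_comm])
    (by
      rintro ⟨⟨a, ha⟩, s⟩ ⟨⟨b, hb⟩, t⟩
      have h1 := hcc a b ha hb
      have h2 : Commute (a : Matrix (Fin d) (Fin d) ℂ) (star (b : Matrix (Fin d) (Fin d) ℂ)) :=
        hcc a b⁻¹ ha (T.inv_mem hb)
      have h3 : Commute (star (a : Matrix (Fin d) (Fin d) ℂ)) (b : Matrix (Fin d) (Fin d) ℂ) :=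
        hcc a⁻¹ b (T.inv_mem ha) hb
      have h4 : Commute (star (a : Matrix (Fin d) (Fin d) ℂ))
        (star (b : Matrix (Fin d) (Fin d) ℂ)) := hcc a⁻¹ b⁻¹ (T.inv_mem ha) (T.inv_mem hb)
      have hp := (h1.add_right h2).add_left (h3.add_right h4)
      have hm := (h1.sub_right h2).add_left (h3.sub_right h4)
      have hp' := (h1.add_right h2).sub_left (h3.add_right h4)
      have hm' := (h1.sub_right h2).sub_left (h3.sub_right h4)
      cases s <;> cases t <;> simp only [A, if_true, Bool.false_eq_true, if_false]
      · exact (hm'.smul_left _).smul_right _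
      · exact hp'.smul_left _
      · exact hm.smul_right _
      · exact hp)
  refine ⟨v, fun g hg => ?_⟩
  obtain ⟨χ, hχ⟩ := hv (⟨g, hg⟩, true)
  obtain ⟨ψ, hψ⟩ := hv (⟨g, hg⟩, false)
  simp only [A, if_true, Bool.false_eq_true, if_false] at hχ hψ
  have hs : star (v : Matrix (Fin d) (Fin d) ℂ) * v = 1 := Unitary.star_mul_self_of_mem v.2
  have hcancel : ∀ D : Matrix (Fin d) (Fin d) ℂ, star (v : Matrix (Fin d) (Fin d) ℂ) *
      (v * D * star (v : Matrix (Fin d) (Fin d) ℂ)) * v = D := by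
    intro D
    calc _ = (star (v : Matrix (Fin d) (Fin d) ℂ) * v) * D *
          (star (v : Matrix (Fin d) (Fin d) ℂ) * v) := by simp only [mul_assoc]
      _ = D := by rw [hs, one_mul, mul_one]
  have hg2 : (g : Matrix (Fin d) (Fin d) ℂ) = (2⁻¹ : ℂ) • (v * Matrix.diagonal χ *
      star (v : Matrix (Fin d) (Fin d) ℂ)) - (2⁻¹ * Complex.I) • (v * Matrix.diagonal ψ *
      star (v : Matrix (Fin d) (Fin d) ℂ)) := by
    rw [← hχ, ← hψ, smul_smul, mul_assoc, Complex.I_mul_I]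
    module
  rw [coe_inv_mul_mul, hg2, mul_sub, sub_mul, mul_smul_comm, mul_smul_comm, smul_mul_assoc,
    smul_mul_assoc, hcancel, hcancel]
  exact ((Matrix.isDiag_diagonal _).smul _).sub ((Matrix.isDiag_diagonal _).smul _)

theorem det_gate (ε : ℝ) (X : LieU d) :
    (gate ε X : Matrix (Fin d) (Fin d) ℂ).det =
      Complex.exp (ε * (X : Matrix (Fin d) (Fin d) ℂ).trace) := by
  have hX : star (X : Matrix (Fin d) (Fin d) ℂ) = -(X : Matrix (Fin d) (Fin d) ℂ) :=
    skewAdjoint.mem_iff.mp X.2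
  obtain ⟨v, hv⟩ := exists_unitary_conj_eq_diagonal
    (fun _ : Unit => Complex.I • (X : Matrix (Fin d) (Fin d) ℂ))
    (fun _ => by simp [star_smul, hX]) (fun _ _ => Commute.refl _)
  obtain ⟨χ, hχ⟩ := hv ()
  have hs : star (v : Matrix (Fin d) (Fin d) ℂ) * v = 1 := Unitary.star_mul_self_of_mem v.2
  have hX2 : (X : Matrix (Fin d) (Fin d) ℂ) =
      v * Matrix.diagonal (-Complex.I • χ) * star (v : Matrix (Fin d) (Fin d) ℂ) := by
    rw [Matrix.diagonal_smul, mul_smul_comm, smul_mul_assoc, ← hχ, smul_smul]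
    simp
  have hdet : ∀ D : Matrix (Fin d) (Fin d) ℂ,
      (v * D * star (v : Matrix (Fin d) (Fin d) ℂ)).det = D.det := fun D => by
    rw [Matrix.det_mul_comm, ← mul_assoc, hs, one_mul]
  have htr : (X : Matrix (Fin d) (Fin d) ℂ).trace = ∑ i, (-Complex.I • χ) i := by
    conv_lhs => rw [hX2]
    rw [Matrix.trace_mul_comm, ← mul_assoc, hs, one_mul, Matrix.trace_diagonal]
  have hexp := Matrix.exp_units_conj (𝔸 := ℂ) (Unitary.toUnits v)
    (Matrix.diagonal (ε • (-Complex.I • χ)))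
  have h1 : ((Unitary.toUnits v : (Matrix (Fin d) (Fin d) ℂ)ˣ) : Matrix (Fin d) (Fin d) ℂ) = v :=
    rfl
  have h2 : (((Unitary.toUnits v)⁻¹ : (Matrix (Fin d) (Fin d) ℂ)ˣ) : Matrix (Fin d) (Fin d) ℂ) =
    star (v : Matrix (Fin d) (Fin d) ℂ) := rfl
  rw [h1, h2] at hexp
  have h3 : (gate ε X : Matrix (Fin d) (Fin d) ℂ) =
      NormedSpace.exp (ε • (X : Matrix (Fin d) (Fin d) ℂ)) := rfl
  rw [h3, htr, hX2, ← smul_mul_assoc, ← mul_smul_comm, ← Matrix.diagonal_smul, hexp, hdet,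
    Matrix.exp_diagonal, Matrix.det_diagonal, Finset.mul_sum, Complex.exp_sum]
  refine Finset.prod_congr rfl fun i _ => ?_
  rw [Pi.coe_exp, ← Complex.exp_eq_exp_ℂ]
  simp

end

/-! ### Identity components. -/

section IdentityComponent

variable {Γ : Type*} [Group Γ] [TopologicalSpace Γ] [IsTopologicalGroup Γ] {H : Subgroup Γ}

theorem coe_identityComponent (H : Subgroup Γ) :
    (identityComponent H : Set Γ) = Subtype.val '' connectedComponent (1 : H) := rfl

theorem identityComponent_le (H : Subgroup Γ) : identityComponent H ≤ H :=
  Subgroup.map_subtype_le _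

theorem isConnected_identityComponent (H : Subgroup Γ) :
    IsConnected (identityComponent H : Set Γ) :=
  isConnected_connectedComponent.image _ continuous_subtype_val.continuousOn

theorem isClosed_identityComponent (hH : IsClosed (H : Set Γ)) :
    IsClosed (identityComponent H : Set Γ) :=
  hH.isClosedEmbedding_subtypeVal.isClosedMap _ isClosed_connectedComponent

theorem subset_identityComponent {S : Set Γ} (hS : IsPreconnected S) (hSH : S ⊆ H)
    (h1 : (1 : Γ) ∈ S) : S ⊆ identityComponent H := by
  let S' : Set H := Subtype.val ⁻¹' S
  have h2 : Subtype.val '' S' = S :=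
    (Subtype.image_preimage_coe (H : Set Γ) S).trans (Set.inter_eq_right.2 hSH)
  have h3 : IsPreconnected S' :=
    Topology.IsInducing.subtypeVal.isPreconnected_image.1 (h2.symm ▸ hS)
  rw [coe_identityComponent, ← h2]
  exact Set.image_mono (h3.subset_connectedComponent h1)

end IdentityComponent

/-! ### Diagonal subgroups and maximal tori. -/

section

variable {d : ℕ}

/-- The group of diagonal matrices in `G`. -/
def diagonalSubgroup (G : Subgroup (U d)) : Subgroup (U d) where
  carrier := {g | g ∈ G ∧ (g : Matrix (Fin d) (Fin d) ℂ).IsDiag}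
  one_mem' := ⟨G.one_mem, Matrix.isDiag_one⟩
  mul_mem' {a b} ha hb := ⟨G.mul_mem ha.1 hb.1, by
    rw [Submonoid.coe_mul, ← ha.2.diagonal_diag, ← hb.2.diagonal_diag, Matrix.diagonal_mul_diagonal]
    exact Matrix.isDiag_diagonal _⟩
  inv_mem' {a} ha := ⟨G.inv_mem ha.1, ha.2.conjTranspose⟩

theorem isClosed_diagonalSubgroup {G : Subgroup (U d)} (hG : IsClosed (G : Set (U d))) :
    IsClosed (diagonalSubgroup G : Set (U d)) := by
  have : (diagonalSubgroup G : Set (U d)) = (G : Set (U d)) ∩ ⋂ (i : Fin d) (j : Fin d) (_ : i ≠ j),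
      {g : U d | (g : Matrix (Fin d) (Fin d) ℂ) i j = 0} := by
    ext g
    simp [diagonalSubgroup, Matrix.IsDiag, Pairwise]
  rw [this]
  refine hG.inter (isClosed_iInter fun i => isClosed_iInter fun j => isClosed_iInter fun _ => ?_)
  exact isClosed_eq (continuous_subtype_val.matrix_elem i j) continuous_const

/-- The diagonal unitary matrix with given diagonal. -/
noncomputable def diagonalUnitary (w : Fin d → Circle) : U d :=
  ⟨Matrix.diagonal fun i => (w i : ℂ), by
    rw [Matrix.mem_unitaryGroup_iff, Matrix.star_eq_conjTranspose, Matrix.diagonal_conjTranspose,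
      Matrix.diagonal_mul_diagonal, ← Matrix.diagonal_one]
    congr 1
    ext i
    simp [Complex.mul_conj]⟩

theorem continuous_diagonalUnitary : Continuous (diagonalUnitary (d := d)) :=
  Continuous.subtype_mk (Continuous.matrix_diagonal (by fun_prop)) _

theorem exists_eq_diagonalUnitary {g : U d} (hg : (g : Matrix (Fin d) (Fin d) ℂ).IsDiag) :
    ∃ w, g = diagonalUnitary w := by
  have h := Matrix.mem_unitaryGroup_iff.1 g.2
  rw [← hg.diagonal_diag, Matrix.star_eq_conjTranspose, Matrix.diagonal_conjTranspose,
    Matrix.diagonal_mul_diagonal] at h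
  refine ⟨fun i => ⟨(g : Matrix (Fin d) (Fin d) ℂ) i i, ?_⟩, ?_⟩
  · have h1 := congrFun (congrFun h i) i
    rw [Matrix.diagonal_apply_eq, Matrix.one_apply_eq, Pi.star_apply, Matrix.diag_apply,
      Complex.star_def, Complex.mul_conj] at h1
    have h2 : Complex.normSq ((g : Matrix (Fin d) (Fin d) ℂ) i i) = 1 := by exact_mod_cast h1
    rw [Complex.normSq_eq_norm_sq] at h2
    exact mem_sphere_zero_iff_norm.2 ((pow_eq_one_iff_of_nonneg (norm_nonneg _) two_ne_zero).1 h2)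
  · apply Subtype.ext
    conv_lhs => rw [← hg.diagonal_diag]
    rfl

theorem mem_SU_iff {g : U d} : g ∈ SU d ↔ (g : Matrix (Fin d) (Fin d) ℂ).det = 1 :=
  ⟨fun h => h.2, fun h => ⟨g.2, h⟩⟩

theorem det_diagonalUnitary (w : Fin d → Circle) :
    (diagonalUnitary w : Matrix (Fin d) (Fin d) ℂ).det = (∏ i, w i : Circle) := by
  rw [diagonalUnitary, Matrix.det_diagonal]
  exact (map_prod Circle.coeHom _ _).symm

theorem isConnected_diagonalSubgroup_top :
    IsConnected (diagonalSubgroup (⊤ : Subgroup (U d)) : Set (U d)) := by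
  have : (diagonalSubgroup (⊤ : Subgroup (U d)) : Set (U d)) = Set.range diagonalUnitary := by
    ext g
    refine ⟨fun hg => ?_, ?_⟩
    · obtain ⟨w, rfl⟩ := exists_eq_diagonalUnitary hg.2
      exact ⟨w, rfl⟩
    · rintro ⟨w, rfl⟩
      exact ⟨trivial, Matrix.isDiag_diagonal _⟩
  rw [this]
  exact isConnected_range continuous_diagonalUnitary

theorem isConnected_diagonalSubgroup_SU :
    IsConnected (diagonalSubgroup (SU d) : Set (U d)) := by
  rcases Nat.eq_zero_or_pos d with rfl | hd
  · have : Subsingleton (U 0) := ⟨fun a b => Subtype.ext (Subsingleton.elim _ _)⟩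
    exact ⟨⟨1, one_mem _⟩, (Set.subsingleton_of_subsingleton).isPreconnected⟩
  let k : Fin d := ⟨0, hd⟩
  -- Dividing one coordinate by the product of all retracts the full torus onto determinant 1, so
  -- the image is connected. This needs a coordinate, hence the separate case `d = 0`.
  let f : (Fin d → Circle) → U d := fun w =>
    diagonalUnitary (w * Pi.mulSingle k (∏ i, w i)⁻¹)
  have hf : Continuous f := by
    refine continuous_diagonalUnitary.comp (continuous_id.mul ?_)
    exact (continuous_mulSingle (A := fun _ : Fin d => Circle) k).comp (by fun_prop)
  have : (diagonalSubgroup (SU d) : Set (U d)) = Set.range f := by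
    ext g
    refine ⟨fun hg => ?_, ?_⟩
    · obtain ⟨w, rfl⟩ := exists_eq_diagonalUnitary hg.2
      refine ⟨w, ?_⟩
      have h1 := mem_SU_iff.1 hg.1
      rw [det_diagonalUnitary] at h1
      have h2 : ∏ i, w i = 1 := Circle.ext h1
      simp [f, h2]
    · rintro ⟨w, rfl⟩
      refine ⟨mem_SU_iff.2 ?_, Matrix.isDiag_diagonal _⟩
      simp only [f]
      rw [det_diagonalUnitary]
      simp [Finset.prod_mul_distrib]
  rw [this]
  exact isConnected_range hf

theorem isClosed_SU : IsClosed (SU d : Set (U d)) := by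
  have : (SU d : Set (U d)) = {g : U d | (g : Matrix (Fin d) (Fin d) ℂ).det = 1} := by
    ext g; exact mem_SU_iff
  rw [this]
  exact isClosed_eq continuous_subtype_val.matrix_det continuous_const

theorem normal_SU : (SU d).Normal := ⟨fun n hn g => by
  rw [mem_SU_iff] at hn ⊢
  have h : ((g * n * g⁻¹ : U d) : Matrix (Fin d) (Fin d) ℂ) =
    g * n * star (g : Matrix (Fin d) (Fin d) ℂ) := rfl
  have hs : star (g : Matrix (Fin d) (Fin d) ℂ) * g = 1 := Unitary.star_mul_self_of_mem g.2
  rw [h, Matrix.det_mul_comm, ← mul_assoc, hs, one_mul, hn]⟩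

theorem gate_mem_SU (ε : ℝ) {X : LieU d} (hX : (X : Matrix (Fin d) (Fin d) ℂ).trace = 0) :
    gate ε X ∈ SU d := by
  rw [mem_SU_iff, det_gate, hX, mul_zero, Complex.exp_zero]

/-- A maximal torus of a closed normal subgroup `G` with connected diagonal subgroup is conjugate
to this diagonal subgroup. -/
theorem IsMaximalTorus.exists_conj_mem {G T : Subgroup (U d)} (hG : IsClosed (G : Set (U d)))
    (hn : G.Normal) (hc : IsConnected (diagonalSubgroup G : Set (U d)))
    (hT : IsMaximalTorus G T) :
    ∃ v : U d, ∀ s ∈ diagonalSubgroup G, v * s * v⁻¹ ∈ T := by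
  obtain ⟨v, hv⟩ := exists_conj_isDiag hT.prop.2.2.2
  -- `S` is a torus of `G` containing `T`, so maximality forces `S ≤ T`.
  let S : Subgroup (U d) := (diagonalSubgroup G).map (MulAut.conj v).toMonoidHom
  have hS : (S : Set (U d)) = (fun g => v * g * v⁻¹) '' diagonalSubgroup G := rfl
  have hTS : T ≤ S := fun g hg =>
    ⟨v⁻¹ * g * v, ⟨by simpa using hn.conj_mem g (hT.prop.1 hg) v⁻¹, hv g hg⟩, by
      simp [mul_assoc]⟩
  have hSt : IsTorusIn G S := by
    refine ⟨?_, ?_, ?_, ?_⟩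
    · rintro _ ⟨g, hg, rfl⟩
      exact hn.conj_mem g hg.1 v
    · rw [hS]
      exact ((Homeomorph.mulRight v⁻¹).isClosedMap.comp (Homeomorph.mulLeft v).isClosedMap) _
        (isClosed_diagonalSubgroup hG)
    · rw [hS]
      exact hc.image _ (by fun_prop)
    · rintro _ ⟨a, ha, rfl⟩ _ ⟨b, hb, rfl⟩
      rw [← map_mul, ← map_mul]
      congr 1
      apply Subtype.ext
      rw [Submonoid.coe_mul, Submonoid.coe_mul, ← ha.2.diagonal_diag, ← hb.2.diagonal_diag]
      exact Matrix.commute_diagonal _ _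
  exact ⟨v, fun s hs => hT.le_of_ge hSt hTS ⟨s, hs, rfl⟩⟩

/-! ### Closeness to the identity implies membership in the identity component. -/

theorem distOne_conj (v g : U d) : distOne (v⁻¹ * g * v) = distOne g := by
  have h : ((v⁻¹ * g * v : U d) : Matrix (Fin d) (Fin d) ℂ) - 1 =
      ((v⁻¹ : U d) : Matrix (Fin d) (Fin d) ℂ) * ((g : Matrix (Fin d) (Fin d) ℂ) - 1) * v := by
    have h1 : ((v⁻¹ : U d) : Matrix (Fin d) (Fin d) ℂ) * v = 1 := Unitary.star_mul_self_of_mem v.2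
    rw [mul_sub, sub_mul, mul_one, h1]; rfl
  rw [distOne_eq_norm, distOne_eq_norm, h, CStarRing.norm_mul_coe_unitary,
    CStarRing.norm_coe_unitary_mul]

theorem gate_zero_left (X : LieU d) : gate 0 X = 1 :=
  Subtype.ext (by simp [gate])

theorem continuous_gate (X : LieU d) : Continuous fun t : ℝ => gate t X := by
  let _ : NormedAlgebra ℚ (Matrix (Fin d) (Fin d) ℂ) := .restrictScalars ℚ ℂ _
  exact Continuous.subtype_mk (NormedSpace.exp_continuous.comp (by fun_prop)) _

/-- Elements of a closed subgroup of maximal rank at distance less than `√2` from the identity lie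
in the identity component. -/
theorem mem_identityComponent_of_distOne_lt {G H : Subgroup (U d)} (hG : IsClosed (G : Set (U d)))
    (hn : G.Normal) (hc : IsConnected (diagonalSubgroup G : Set (U d)))
    (hgate : ∀ (t : ℝ) (X : LieU d), (X : Matrix (Fin d) (Fin d) ℂ).trace = 0 → gate t X ∈ G)
    (hH : IsClosed (H : Set (U d))) (hr : HasMaximalRank G H) {g : U d} (hg : g ∈ H)
    (hd : distOne g < √2) : g ∈ identityComponent H := by
  obtain ⟨hHG, T, hT, hTH⟩ := hr
  obtain ⟨v, hv⟩ := hT.exists_conj_mem hG hn hc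
  let K : Subgroup (U d) := H.comap (MulAut.conj v).toMonoidHom
  have hKmem : ∀ x, x ∈ K ↔ v * x * v⁻¹ ∈ H := fun x => Iff.rfl
  have hK : IsClosed (K : Set (U d)) :=
    hH.preimage (show Continuous fun x => v * x * v⁻¹ by fun_prop)
  have hKG : K ≤ G := fun x hx => by
    have := hn.conj_mem _ (hHG ((hKmem x).1 hx)) v⁻¹
    simpa [mul_assoc] using this
  have hD : ContainsCartan K := by
    intro θ hθ
    have hs : star (Matrix.diagonal fun k => Complex.I * (θ k : ℂ)) =
        -Matrix.diagonal fun k => Complex.I * (θ k : ℂ) := by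
      rw [Matrix.star_eq_conjTranspose, Matrix.diagonal_conjTranspose]
      ext a b
      by_cases hab : a = b
      · subst hab; simp
      · simp [hab]
    refine ⟨hs, fun t => ⟨gate t ⟨_, skewAdjoint.mem_iff.2 hs⟩, hTH (hv _ ⟨hgate _ _ ?_, ?_⟩), rfl⟩⟩
    · rw [Matrix.trace_diagonal, ← Finset.mul_sum]
      rw [← Complex.ofReal_sum, hθ]
      simp
    · let _ : NormedAlgebra ℚ (Matrix (Fin d) (Fin d) ℂ) := .restrictScalars ℚ ℂ _
      change (NormedSpace.exp (t • Matrix.diagonal fun k => Complex.I * (θ k : ℂ))).IsDiag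
      rw [← Matrix.diagonal_smul, Matrix.exp_diagonal]
      exact Matrix.isDiag_diagonal _
  have hg' : v⁻¹ * g * v ∈ K := by
    rw [hKmem]
    simpa [mul_assoc] using hg
  obtain ⟨X, hX, s, hs, hsd, hgs⟩ := exists_eq_exp_mul_scalar hK hD hg'
    (by rwa [distOne_conj])
  -- The image of `ℝ × diagonalSubgroup G` is a connected subset of `H` containing `1 = f (0, 1)`
  -- and `g = f (1, s)`. Letting the second factor vary matters: for `SU(d)` the logarithm of `g`
  -- may have nonzero trace, and then `s` need not be `1`.
  let f : ℝ × U d → U d := fun p => v * (gate p.1 X * p.2) * v⁻¹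
  have hf : Continuous f := by
    have := continuous_gate X
    fun_prop
  have hS : IsPreconnected (f '' (Set.univ ×ˢ (diagonalSubgroup G : Set (U d)))) :=
    (isPreconnected_univ.prod hc.isPreconnected).image _ hf.continuousOn
  refine subset_identityComponent hS ?_ ⟨(0, 1), ⟨trivial, one_mem _⟩, by simp [f, gate_zero_left]⟩
    ⟨(1, s), ⟨trivial, hKG hs, hsd⟩, ?_⟩
  · rintro _ ⟨⟨t, x⟩, ⟨-, hx⟩, rfl⟩
    exact K.mul_mem (hX t) (hTH (hv x hx))
  · simp only [f]
    rw [← hgs]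
    simp [mul_assoc]

/-! ### Groups generated by gates. -/

theorem gate_mem_gateGroup {m : ℕ} (ε : ℝ) (X : Fin m → LieU d) (i : Fin m) :
    gate ε (X i) ∈ gateGroup ε X :=
  Subgroup.le_topologicalClosure _ (Subgroup.subset_closure ⟨i, rfl⟩)

theorem gateGroup_connected_of_forall_mem {m : ℕ} {ε : ℝ} {X : Fin m → LieU d}
    (h : ∀ i, gate ε (X i) ∈ identityComponent (gateGroup ε X)) :
    IsConnected (gateGroup ε X : Set (U d)) ∧
      gateGroup ε X = identityComponent (gateGroup ε X) := by
  have hcl : IsClosed (gateGroup ε X : Set (U d)) := Subgroup.isClosed_topologicalClosure _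
  have heq : gateGroup ε X = identityComponent (gateGroup ε X) := by
    refine le_antisymm ?_ (identityComponent_le _)
    refine Subgroup.topologicalClosure_minimal _ ?_ (isClosed_identityComponent hcl)
    rw [Subgroup.closure_le]
    rintro _ ⟨i, rfl⟩
    exact h i
  refine ⟨?_, heq⟩
  rw [heq]
  exact isConnected_identityComponent _

theorem hasMaximalRank_gateGroup {G : Subgroup (U d)} (hG : IsClosed (G : Set (U d))) {m : ℕ}
    {ε : ℝ} {X : Fin m → LieU d} (hX : ∀ i, gate ε (X i) ∈ G)
    (h : ∃ i, IsGeneralElement G (gate ε (X i))) : HasMaximalRank G (gateGroup ε X) := by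
  obtain ⟨i, T, hT, hcl⟩ := h
  refine ⟨Subgroup.topologicalClosure_minimal _ ?_ hG, T, hT, ?_⟩
  · rw [Subgroup.closure_le]
    rintro _ ⟨j, rfl⟩
    exact hX j
  · rw [← SetLike.coe_subset_coe, ← hcl]
    refine closure_minimal ?_ (Subgroup.isClosed_topologicalClosure _)
    rintro _ ⟨k, rfl⟩
    exact pow_mem (gate_mem_gateGroup ε X i) k

theorem exists_forall_distOne_gate_lt {m : ℕ} (X : Fin m → LieU d) :
    ∃ ε₀ : ℝ, 0 < ε₀ ∧ ∀ ε : ℝ, 0 < ε → ε < ε₀ → ∀ i, distOne (gate ε (X i)) < √2 := by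
  have h : ∀ᶠ ε in 𝓝 (0 : ℝ), ∀ i, distOne (gate ε (X i)) < √2 := by
    rw [eventually_all]
    intro i
    have hc : Continuous fun ε : ℝ => distOne (gate ε (X i)) := by
      exact ((continuous_subtype_val.comp (continuous_gate (X i))).sub continuous_const).norm
    refine hc.continuousAt.eventually_lt continuousAt_const ?_
    simp [gate_zero_left, distOne_eq_norm]
  obtain ⟨ε₀, h0, hε₀⟩ := Metric.eventually_nhds_iff.1 h
  refine ⟨ε₀, h0, fun ε h1 h2 => hε₀ ?_⟩
  rwa [Real.dist_eq, sub_zero, abs_of_pos h1]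

end

end SmallStep

theorem mainTheorem4 (d : ℕ) (G : Subgroup (SmallStep.U d)) (𝔤 : Set (SmallStep.LieU d))
    (hG : (G = ⊤ ∧ 𝔤 = Set.univ) ∨ (G = SmallStep.SU d ∧ 𝔤 = SmallStep.LieSU d)) :
    -- elements outside the identity component are far from the identity
    (∀ H : Subgroup (SmallStep.U d), IsClosed (H : Set (SmallStep.U d)) →
      SmallStep.HasMaximalRank G H → H ≠ SmallStep.identityComponent H →
      ∀ g ∈ H, g ∉ SmallStep.identityComponent H → √2 ≤ SmallStep.distOne g) ∧
    ∀ (m : ℕ) (X : Fin m → SmallStep.LieU d), (∀ i, X i ∈ 𝔤) →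
      -- the explicit smallness condition on `ε` makes `H_ε` connected when it has maximal rank
      (∀ ε : ℝ, 0 < ε → (∀ i, SmallStep.distOne (SmallStep.gate ε (X i)) < √2) →
        SmallStep.HasMaximalRank G (SmallStep.gateGroup ε X) →
        IsConnected (SmallStep.gateGroup ε X : Set (SmallStep.U d)) ∧
          SmallStep.gateGroup ε X =
            SmallStep.identityComponent (SmallStep.gateGroup ε X)) ∧
      -- all sufficiently small `ε` satisfy this condition, so that `H_ε` is connected when it has
      -- maximal rank, in particular when one of the gates is a general element of `G`
      ∃ ε₀ : ℝ, 0 < ε₀ ∧ ∀ ε : ℝ, 0 < ε → ε < ε₀ →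
        (∀ i, SmallStep.distOne (SmallStep.gate ε (X i)) < √2) ∧
        ((SmallStep.HasMaximalRank G (SmallStep.gateGroup ε X) ∨
            ∃ i, SmallStep.IsGeneralElement G (SmallStep.gate ε (X i))) →
          IsConnected (SmallStep.gateGroup ε X : Set (SmallStep.U d)) ∧
            SmallStep.gateGroup ε X =
              SmallStep.identityComponent (SmallStep.gateGroup ε X)) := by
  have hclosed : IsClosed (G : Set (SmallStep.U d)) := by
    rcases hG with ⟨rfl, -⟩ | ⟨rfl, -⟩
    · exact isClosed_univ
    · exact SmallStep.isClosed_SU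
  have hnormal : G.Normal := by
    rcases hG with ⟨rfl, -⟩ | ⟨rfl, -⟩
    · infer_instance
    · exact SmallStep.normal_SU
  have hconn : IsConnected (SmallStep.diagonalSubgroup G : Set (SmallStep.U d)) := by
    rcases hG with ⟨rfl, -⟩ | ⟨rfl, -⟩
    · exact SmallStep.isConnected_diagonalSubgroup_top
    · exact SmallStep.isConnected_diagonalSubgroup_SU
  have htrace : ∀ (t : ℝ) (X : SmallStep.LieU d),
      (X : Matrix (Fin d) (Fin d) ℂ).trace = 0 → SmallStep.gate t X ∈ G := by
    intro t X hX
    rcases hG with ⟨rfl, -⟩ | ⟨rfl, -⟩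
    · trivial
    · exact SmallStep.gate_mem_SU t hX
  have hgate : ∀ (t : ℝ), ∀ X ∈ 𝔤, SmallStep.gate t X ∈ G := by
    intro t X hX
    rcases hG with ⟨rfl, -⟩ | ⟨rfl, rfl⟩
    · trivial
    · exact SmallStep.gate_mem_SU t hX
  have key : ∀ H : Subgroup (SmallStep.U d), IsClosed (H : Set (SmallStep.U d)) →
      SmallStep.HasMaximalRank G H → ∀ g ∈ H, SmallStep.distOne g < √2 →
      g ∈ SmallStep.identityComponent H := fun H hH hr g hg hd =>
    SmallStep.mem_identityComponent_of_distOne_lt hclosed hnormal hconn htrace hH hr hg hd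
  have hconnected : ∀ (m : ℕ) (X : Fin m → SmallStep.LieU d) (ε : ℝ),
      (∀ i, SmallStep.distOne (SmallStep.gate ε (X i)) < √2) →
      SmallStep.HasMaximalRank G (SmallStep.gateGroup ε X) →
      IsConnected (SmallStep.gateGroup ε X : Set (SmallStep.U d)) ∧
        SmallStep.gateGroup ε X =
          SmallStep.identityComponent (SmallStep.gateGroup ε X) := fun m X ε hd hr =>
    SmallStep.gateGroup_connected_of_forall_mem fun i =>
      key _ (Subgroup.isClosed_topologicalClosure _) hr _ (SmallStep.gate_mem_gateGroup ε X i) (hd i)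
  refine ⟨fun H hH hr _ g hg hgn => ?_, fun m X hX => ⟨fun ε _ hd hr => hconnected m X ε hd hr, ?_⟩⟩
  · by_contra! hlt
    exact hgn (key H hH hr g hg hlt)
  · obtain ⟨ε₀, h0, hε₀⟩ := SmallStep.exists_forall_distOne_gate_lt X
    refine ⟨ε₀, h0, fun ε h1 h2 => ⟨hε₀ ε h1 h2, fun h => hconnected m X ε (hε₀ ε h1 h2) ?_⟩⟩
    exact h.elim id fun hgen =>
      SmallStep.hasMaximalRank_gateGroup hclosed (fun i => hgate ε _ (hX i)) hgen
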